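/- Let $p=1$ or let $p\ge 2$ be even. Let $H_1,\dots,H_L$ be (bounded) self-adjoint operators on a complex Hilbert space, e.g. Hermitian matrices, and $H=\sum_{l=1}^L H_l$. Let $\mathscr U_p(t)$ be the $p$-th order product formula: $$\mathscr U_1(t)=e^{-itH_1}e^{-itH_2}\cdots e^{-itH_L},\qquad \mathscr U_2(t)=e^{-i\frac t2H_1}\cdots e^{-i\frac t2H_L}\,e^{-i\frac t2H_L}\cdots e^{-i\frac t2H_1},$$ $$\mathscr U_{2k}(t)=[\mathscr U_{2k-2}(p_kt)]^2\,\mathscr U_{2k-2}((1-4p_k)t)\,[\mathscr U_{2k-2}(p_kt)]^2,\qquad p_k=\frac1{4-4^{1/(2k-1)}}\quad(k\ge 2).$$ Define the multiplicative error $\mathscr M(\delta t)$ by $\mathscr U_p(\delta t)=e^{-iH\delta t}(I+\mathscr M(\delta t))$, and for $n\ge 2$ put $$\alpha_n=\sum_{l_1,\dots,l_n=1}^L\big\|[H_{l_1},[H_{l_2},\dots,[H_{l_{n-1}},H_{l_n}]]]\big\|.$$ Then there are a constant $C>0$ depending only on $p$, and real coefficients $c_{l_1,\dots,l_{p+1}}$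 depending only on $p$ and $L$, with $|c_{l_1,\dots,l_{p+1}}|\le C$, such that the following holds. Let $(M_j)$ be any finite family of operators that decomposes the leading error term, $$\sum_jM_j=\sum_{l_1,\dots,l_{p+1}=1}^L c_{l_1,\dots,l_{p+1}}\,[-iH_{l_1},[-iH_{l_2},\dots,[-iH_{l_p},-iH_{l_{p+1}}]]],$$ and define $\mathscr M_{Re}(\delta t)$ by $\mathscr M(\delta t)=\sum_jM_j\,\delta t^{p+1}+\mathscr M_{Re}(\delta t)$. Then: 1. For every $\delta t\ge 0$, every observable (bounded self-adjoint operator) $O$ and every unit vector $|\psi\rangle$, with $O(\delta t)=e^{iH\delta t}Oe^{-iH\delta t}$, $$\epsilon_O:=\big|\langle\psi|\,e^{iH\delta t}Oe^{-iH\delta t}-\mathscr U_p(\delta t)^\dagger O\,\mathscr U_p(\delta t)\,|\psi\rangle\big|\le\Big\|\Big[O(\delta t),\sum_jM_j\Big]|\psi\rangle\Big\|\,\delta t^{p+1}+2\|O\|\,\|\mathscr M_{Re}(\delta t)\|.$$ 2. $\|\mathscr M_{Re}(\delta t)\|=\mathcal O(\alpha_{p+2}\,\delta t^{p+2})$ as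 $\delta t\to0^+$: there is $\delta_0>0$, depending on the $H_l$, such that $\|\mathscr M_{Re}(\delta t)\|\le C\,\alpha_{p+2}\,\delta t^{p+2}$ for all $0\le\delta t\le\delta_0$. -/

import Mathlib

noncomputable section

namespace Trotter

variable {A : Type*} [NormedRing A] [NormedAlgebra ℂ A]

/-- The evolution `e^{-i t H}` generated by `H`; in particular `e^{i t H} = evolution H (-t)`. -/
def evolution (H : A) (t : ℝ) : A :=
  NormedSpace.exp ((-(Complex.I * (t : ℂ))) • H)

/-- The ordered product `e^{-i t H_1} e^{-i t H_2} ⋯ e^{-i t H_L}`. -/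
def forwardProd {L : ℕ} (H : Fin L → A) (t : ℝ) : A :=
  (List.ofFn fun l => evolution (H l) t).prod

/-- The ordered product `e^{-i t H_L} ⋯ e^{-i t H_2} e^{-i t H_1}`. -/
def backwardProd {L : ℕ} (H : Fin L → A) (t : ℝ) : A :=
  (List.ofFn fun l => evolution (H l) t).reverse.prod

/-- Suzuki's parameter `p_k = 1 / (4 - 4^{1/(2k-1)})`, written in terms of `m = 2k - 1`. -/
def suzukiParam (m : ℕ) : ℝ :=
  1 / (4 - (4 : ℝ) ^ (1 / (m : ℝ)))

/-- The `p`-th order product formula: Lie-Trotter for `p = 1`, Strang for `p = 2`, and Suzuki's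
recursion `U_{2k}(t) = U_{2k-2}(p_k t)^2 U_{2k-2}((1 - 4 p_k) t) U_{2k-2}(p_k t)^2` for
`p = 2k ≥ 4` (in the last clause `2k = q + 3`, hence `2k - 2 = q + 1` and `2k - 1 = q + 2`).
Only the values at `p = 1` and at even `p ≥ 2` are meaningful. -/
def productFormula {L : ℕ} (H : Fin L → A) : ℕ → ℝ → A
  | 0, _ => 1
  | 1, t => forwardProd H t
  | 2, t => forwardProd H (t / 2) * backwardProd H (t / 2)
  | q + 3, t =>
      productFormula H (q + 1) (suzukiParam (q + 2) * t) ^ 2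
        * productFormula H (q + 1) ((1 - 4 * suzukiParam (q + 2)) * t)
        * productFormula H (q + 1) (suzukiParam (q + 2) * t) ^ 2

/-- The right-nested commutator `[X_0, [X_1, …, [X_{k-1}, X_k]]]` of `k + 1` operators. -/
def nestedComm : (k : ℕ) → (Fin (k + 1) → A) → A
  | 0, X => X 0
  | k + 1, X => ⁅X 0, nestedComm k (Fin.tail X)⁆

/-- `α_n = ∑_{l_1, …, l_n} ‖[H_{l_1}, [H_{l_2}, …, [H_{l_{n-1}}, H_{l_n}]]]‖` for `n = k + 1`. -/
def commNormSum {L : ℕ} (H : Fin L → A) (k : ℕ) : ℝ :=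
  ∑ l : Fin (k + 1) → Fin L, ‖nestedComm k fun i => H (l i)‖

/-- The multiplicative error `M(t) = e^{i t H} U_p(t) - 1` with `H = ∑_l H_l`, i.e. the unique
solution of `U_p(t) = e^{-i t H} (1 + M(t))`. -/
def multError {L : ℕ} (H : Fin L → A) (p : ℕ) (t : ℝ) : A :=
  evolution (∑ l, H l) (-t) * productFormula H p t - 1

/-- The combination of `(p+1)`-fold nested commutators of the `-i H_l` with real
coefficients `c`. -/
def commComb {L : ℕ} (H : Fin L → A) (p : ℕ) (c : (Fin (p + 1) → Fin L) → ℝ) : A :=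
  ∑ l : Fin (p + 1) → Fin L, (c l : ℂ) • nestedComm p fun i => (-Complex.I) • H (l i)

/-- The Heisenberg-evolved observable `O(t) = e^{i t H} O e^{-i t H}`. -/
def heisenberg (H O : A) (t : ℝ) : A :=
  evolution H (-t) * O * evolution H t

/-- The observable error
`|⟨ψ| e^{i t H} O e^{-i t H} - U_p(t)† O U_p(t) |ψ⟩|` with `H = ∑_l H_l`. -/
def observableError {E : Type*} [NormedAddCommGroup E] [InnerProductSpace ℂ E] [CompleteSpace E]
    {L : ℕ} (H : Fin L → (E →L[ℂ] E)) (p : ℕ) (t : ℝ) (O : E →L[ℂ] E) (ψ : E) : ℝ :=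
  ‖inner ℂ ψ ((heisenberg (∑ l, H l) O t
    - ContinuousLinearMap.adjoint (productFormula H p t) * O * productFormula H p t) ψ)‖

end Trotter

end

/-! Put `X_l = -i H_l` and encode a product of exponentials by its noncommutative power series `S =
∑ s(w) w` in the letters `t X_l`. Such a series satisfies a Dynkin identity: replacing every word by
its right-nested commutator gives the logarithmic derivative `(t dS/dt) S⁻¹`. This holds for one
exponential (`isGroupLike_expWord`) and passes to products (`IsGroupLike.mul`). The series of `1 +
M` is `1 + O(t^(p+1))` by Suzuki's order conditions, so in degrees `m < 2 (p + 1)` the identity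
reduces to `m S_m` = a combination of nested commutators (`IsGroupLike.coeff_eq_dynkin`). Degree `p
+ 1` is the leading term, and degree `p + 2` is bounded by a multiple of `α_{p+2}`. The multiple
does not depend on `L`, because each ordered product contains a letter only once and a word can then
be cut among its factors in essentially one way.

The remaining tail is `O(t^(p+3))` with a constant depending on `H`. If `α_{p+2} > 0`, it is
absorbed for small `t`. If `α_{p+2} = 0`, self-adjointness turns `[H_l, [H_l, Y]] = 0` into `[H_l,
Y] = 0`; all nested commutators of `p + 1` operators vanish, and then `M = 0` exactly.

The observable bound rests on unitarity of `W = 1 + M`: for `Q = O(t)` one has `Q - W† Q W = -W† [Q,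
M]`, which has no quadratic term to estimate. -/

noncomputable section

namespace Trotter

open Finset PowerSeries

/-! ### Noncommutative power series and the Dynkin identity. -/

section Words

variable {ι : Type*}

/-- The Cauchy product of two noncommutative formal power series, given by their coefficients on
words. -/
def wordMul : (List ι → ℝ) → (List ι → ℝ) → List ι → ℝ
  | s, s', [] => s [] * s' []
  | s, s', i :: w => wordMul (fun v => s (i :: v)) s' w + s [] * s' (i :: w)

/-- The series whose coefficient on a word of length `n` is `g n` if all letters belong to `T`, and
zero otherwise. -/
def powWord [DecidableEq ι] (T : Finset ι) (g : ℕ → ℝ) (w : List ι) : ℝ :=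
  if ∀ i ∈ w, i ∈ T then g w.length else 0

/-- The series of `exp (a ∑_{i ∈ T} X_i)`. -/
def expWord [DecidableEq ι] (T : Finset ι) (a : ℝ) : List ι → ℝ :=
  powWord T fun n => a ^ n / n.factorial

theorem powWord_cons [DecidableEq ι] (T : Finset ι) (g : ℕ → ℝ) (i : ι) :
    (fun w => powWord T g (i :: w))
      = fun w => (if i ∈ T then (1 : ℝ) else 0) * powWord T (fun n => g (n + 1)) w := by
  funext w
  by_cases hi : i ∈ T <;> simp [powWord, hi]

theorem wordMul_zero_left (s' : List ι → ℝ) (w : List ι) : wordMul (fun _ => 0) s' w = 0 := by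
  induction w with
  | nil => simp [wordMul]
  | cons i w ih => simp [wordMul, ih]

variable [Fintype ι]

section Action

variable {M : Type*} [AddCommGroup M] [Module ℝ M]

/-- The action of a noncommutative power series on a sequence `X`, regarded as a power series in
`t`, where the `i`-th letter acts as `t φ_i`. -/
def wordAct (φ : ι → Module.End ℝ M) : (List ι → ℝ) → (ℕ → M) → ℕ → M
  | s, X, 0 => s [] • X 0
  | s, X, n + 1 => s [] • X (n + 1) + ∑ i, φ i (wordAct φ (fun w => s (i :: w)) X n)

/-- Stripping the first letter from a `wordMul` produces a combination `s + c s'`, so this form of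
linearity is what the induction for products needs. -/
theorem wordAct_add_smul (φ : ι → Module.End ℝ M) (s s' : List ι → ℝ) (c : ℝ) (X : ℕ → M) (n : ℕ) :
    wordAct φ (fun w => s w + c * s' w) X n = wordAct φ s X n + c • wordAct φ s' X n := by
  induction n generalizing s s' with
  | zero => simp [wordAct, add_smul, mul_smul]
  | succ n ih =>
    simp only [wordAct, ih, map_add, map_smul, sum_add_distrib, smul_add, smul_sum, add_smul,
      mul_smul]
    abel

theorem wordAct_zero (φ : ι → Module.End ℝ M) (X : ℕ → M) (n : ℕ) :
    wordAct φ (fun _ => 0) X n = 0 := by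
  induction n with
  | zero => simp [wordAct]
  | succ n ih => simp [wordAct, ih]

theorem wordAct_smul (φ : ι → Module.End ℝ M) (s : List ι → ℝ) (c : ℝ) (X : ℕ → M) (n : ℕ) :
    wordAct φ (fun w => c * s w) X n = c • wordAct φ s X n := by
  simpa [wordAct_zero] using wordAct_add_smul φ (fun _ => 0) s c X n

theorem wordAct_mul (φ : ι → Module.End ℝ M) (s s' : List ι → ℝ) (X : ℕ → M) (n : ℕ) :
    wordAct φ (wordMul s s') X n = wordAct φ s (wordAct φ s' X) n := by
  induction n generalizing s with
  | zero => simp [wordAct, wordMul, mul_smul]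
  | succ n ih =>
    simp only [wordAct, wordMul, wordAct_add_smul, ih, map_add, map_smul, sum_add_distrib,
      smul_add, smul_sum, mul_smul]
    abel

theorem wordAct_powWord [DecidableEq ι] (φ : ι → Module.End ℝ M) (T : Finset ι) (g : ℕ → ℝ)
    (X : ℕ → M) (n : ℕ) :
    wordAct φ (powWord T g) X n
      = ∑ k ∈ antidiagonal n, g k.1 • ((∑ i ∈ T, φ i) ^ k.1) (X k.2) := by
  induction n generalizing g with
  | zero => simp [wordAct, powWord]
  | succ n ih =>
    rw [Nat.sum_antidiagonal_succ]
    have hite (i : ι) (Y : M) :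
        φ i ((if i ∈ T then (1 : ℝ) else 0) • Y) = if i ∈ T then φ i Y else 0 := by
      split_ifs <;> simp
    simp only [wordAct, powWord_cons, wordAct_smul, ih, hite, sum_ite_mem, univ_inter]
    congr 1
    simp only [map_sum, map_smul, pow_succ', Module.End.mul_apply]
    rw [sum_comm]
    simp [LinearMap.sum_apply, smul_sum]

end Action

variable {B : Type*} [Ring B] [Algebra ℝ B]

/-- The power series in `t` obtained by substituting `t x_i` for the `i`-th letter. -/
def wordSeries (x : ι → B) (s : List ι → ℝ) : B⟦X⟧ :=
  PowerSeries.mk (wordAct (fun i => LinearMap.mulLeft ℝ (x i)) s fun n => if n = 0 then 1 else 0)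

/-- The action of a noncommutative power series on `B⟦X⟧` through commutators. -/
def adAct (x : ι → B) (s : List ι → ℝ) (Y : B⟦X⟧) : B⟦X⟧ :=
  PowerSeries.mk (wordAct
    (fun i => LinearMap.mulLeft ℝ (x i) - LinearMap.mulRight ℝ (x i)) s fun n => coeff n Y)

/-- Coefficients of the series in which every word is replaced by its right-nested commutator. -/
def dynkinCoeff (x : ι → B) : (List ι → ℝ) → ℕ → B
  | _, 0 => 0
  | s, n + 1 => ∑ i, ((if n = 0 then s [i] else 0) • x i
      + ⁅x i, dynkinCoeff x (fun w => s (i :: w)) n⁆)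

/-- The series in which every word is replaced by its right-nested commutator. -/
def dynkin (x : ι → B) (s : List ι → ℝ) : B⟦X⟧ := PowerSeries.mk (dynkinCoeff x s)

/-- The Euler derivation `t d/dt`. -/
def euler {B : Type*} [Ring B] (P : B⟦X⟧) : B⟦X⟧ := PowerSeries.mk fun n => n • coeff n P

theorem euler_mul {B : Type*} [Ring B] (P Q : B⟦X⟧) : euler (P * Q) = euler P * Q + P * euler Q := by
  ext n
  simp only [euler, coeff_mk, map_add, coeff_mul, smul_sum, ← sum_add_distrib]
  refine sum_congr rfl fun k hk => ?_
  rw [← HasAntidiagonal.mem_antidiagonal.1 hk, add_smul, smul_mul_assoc, mul_smul_comm]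

theorem wordAct_mulLeft (x : ι → B) (s : List ι → ℝ) (Y : B⟦X⟧) (n : ℕ) :
    wordAct (fun i => LinearMap.mulLeft ℝ (x i)) s (fun n => coeff n Y) n
      = coeff n (wordSeries x s * Y) := by
  induction n generalizing s with
  | zero => simp [wordAct, wordSeries, coeff_mul]
  | succ n ih =>
    rw [coeff_mul, Nat.sum_antidiagonal_succ]
    simp only [wordAct, ih, wordSeries, coeff_mk, coeff_mul]
    simp [sum_mul, mul_assoc]
    rw [sum_comm]

theorem wordSeries_mul (x : ι → B) (s s' : List ι → ℝ) :
    wordSeries x (wordMul s s') = wordSeries x s * wordSeries x s' := by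
  ext n
  rw [← wordAct_mulLeft]
  simp only [wordSeries, coeff_mk, wordAct_mul]

theorem adAct_mul (x : ι → B) (s s' : List ι → ℝ) (Y : B⟦X⟧) :
    adAct x (wordMul s s') Y = adAct x s (adAct x s' Y) := by
  ext n
  simp only [adAct, coeff_mk, wordAct_mul]

theorem dynkinCoeff_add_smul (x : ι → B) (s s' : List ι → ℝ) (c : ℝ) (n : ℕ) :
    dynkinCoeff x (fun w => s w + c * s' w) n = dynkinCoeff x s n + c • dynkinCoeff x s' n := by
  induction n generalizing s s' with
  | zero => simp [dynkinCoeff]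
  | succ n ih =>
    simp only [dynkinCoeff, ih, Ring.lie_def, ← sum_add_distrib, smul_sum]
    refine sum_congr rfl fun i _ => ?_
    split_ifs <;> simp only [mul_add, add_mul, mul_smul_comm, smul_mul_assoc, smul_add, smul_sub,
      add_smul, mul_smul, zero_smul, smul_zero] <;> abel

theorem dynkinCoeff_zero (x : ι → B) (n : ℕ) : dynkinCoeff x (fun _ => 0) n = 0 := by
  induction n with
  | zero => simp [dynkinCoeff]
  | succ n ih => simp [dynkinCoeff, ih, Ring.lie_def]

theorem dynkinCoeff_smul (x : ι → B) (s : List ι → ℝ) (c : ℝ) (n : ℕ) :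
    dynkinCoeff x (fun w => c * s w) n = c • dynkinCoeff x s n := by
  simpa [dynkinCoeff_zero] using dynkinCoeff_add_smul x (fun _ => 0) s c n

/-- If a word is cut as `w w'` with `w'` nonempty, its nested commutator is `ad_w` applied to that
of `w'`. The cut with `w'` empty gives the second summand, since the empty word has nested
commutator zero. -/
theorem dynkinCoeff_mul (x : ι → B) (s s' : List ι → ℝ) (n : ℕ) :
    dynkinCoeff x (wordMul s s') n
      = coeff n (adAct x s (dynkin x s')) + s' [] • dynkinCoeff x s n := by
  induction n generalizing s with
  | zero => simp [dynkinCoeff, adAct, wordAct, dynkin]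
  | succ n ih =>
    simp only [adAct, coeff_mk, dynkin] at ih ⊢
    simp only [wordAct, dynkinCoeff, wordMul, dynkinCoeff_add_smul, ih, smul_sum,
      ← sum_add_distrib]
    refine sum_congr rfl fun i _ => ?_
    simp only [Ring.lie_def, LinearMap.sub_apply, LinearMap.mulLeft_apply,
      LinearMap.mulRight_apply]
    split_ifs <;> simp only [mul_add, add_mul, mul_smul_comm, smul_mul_assoc, smul_add, smul_sub,
      add_smul, mul_smul, zero_smul, smul_zero, mul_comm (s [i])] <;> abel

theorem dynkin_mul (x : ι → B) (s s' : List ι → ℝ) (h : s' [] = 1) :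
    dynkin x (wordMul s s') = adAct x s (dynkin x s') + dynkin x s := by
  ext n
  simp only [map_add, dynkin, coeff_mk, dynkinCoeff_mul, h, one_smul]

/-- Series that behave like products of exponentials: conjugation by the series is given by the
adjoint action, and the nested commutator series is the logarithmic derivative. -/
structure IsGroupLike (x : ι → B) (s : List ι → ℝ) : Prop where
  nil : s [] = 1
  conj : ∀ Y : B⟦X⟧, adAct x s Y * wordSeries x s = wordSeries x s * Y
  logDeriv : dynkin x s * wordSeries x s = euler (wordSeries x s)

/-- This is the cocycle rule `(PQ)' (PQ)⁻¹ = P' P⁻¹ + P (Q' Q⁻¹) P⁻¹`, written without inverses;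
`conj` identifies conjugation by `P` with the adjoint action. -/
theorem IsGroupLike.mul {x : ι → B} {s s' : List ι → ℝ} (h : IsGroupLike x s)
    (h' : IsGroupLike x s') : IsGroupLike x (wordMul s s') where
  nil := by simp [wordMul, h.nil, h'.nil]
  conj Y := by
    rw [adAct_mul, wordSeries_mul, ← mul_assoc, h.conj, mul_assoc, h'.conj, mul_assoc]
  logDeriv := by
    rw [dynkin_mul _ _ _ h'.nil, wordSeries_mul, add_mul, ← mul_assoc, h.conj, mul_assoc,
      h'.logDeriv, ← mul_assoc, h.logDeriv, euler_mul, add_comm]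

theorem coeff_wordSeries_powWord [DecidableEq ι] (x : ι → B) (T : Finset ι) (g : ℕ → ℝ) (n : ℕ) :
    coeff n (wordSeries x (powWord T g)) = g n • (∑ i ∈ T, x i) ^ n := by
  have hs : ∑ i ∈ T, LinearMap.mulLeft ℝ (x i) = LinearMap.mulLeft ℝ (∑ i ∈ T, x i) := by
    ext; simp [sum_mul]
  rw [wordSeries, coeff_mk, wordAct_powWord, hs, sum_eq_single (n, 0)]
  · simp [LinearMap.pow_mulLeft]
  · rintro ⟨a, b⟩ hk hne
    have : b ≠ 0 := by
      rintro rfl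
      exact hne (by simpa using hk)
    simp [this]
  · simp

theorem coeff_wordSeries_expWord [DecidableEq ι] (x : ι → B) (T : Finset ι) (a : ℝ) (n : ℕ) :
    coeff n (wordSeries x (expWord T a)) = (a ^ n / n.factorial) • (∑ i ∈ T, x i) ^ n :=
  coeff_wordSeries_powWord ..

/-- Summed over all words in `T`, the innermost bracket is `[y, y] = 0` with `y = ∑ x_i`, so only
degree one survives. -/
theorem dynkinCoeff_powWord_succ [DecidableEq ι] (x : ι → B) (T : Finset ι) (g : ℕ → ℝ) (n : ℕ) :
    dynkinCoeff x (powWord T g) (n + 1) = if n = 0 then g 1 • ∑ i ∈ T, x i else 0 := by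
  induction n generalizing g with
  | zero => simp [dynkinCoeff, powWord, smul_sum, Ring.lie_def]
  | succ n ih =>
    have hite (i : ι) (Y : B) :
        ⁅x i, (if i ∈ T then (1 : ℝ) else 0) • Y⁆ = if i ∈ T then ⁅x i, Y⁆ else 0 := by
      split_ifs <;> simp [Ring.lie_def]
    rw [dynkinCoeff]
    simp only [powWord_cons, dynkinCoeff_smul, ih, hite, sum_add_distrib, sum_ite_mem, univ_inter]
    rw [if_neg n.succ_ne_zero]
    simp only [n.succ_ne_zero, if_false, zero_smul, sum_const_zero, zero_add, Ring.lie_def,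
      sum_sub_distrib, ← sum_mul, ← mul_sum]
    split_ifs <;> simp

theorem dynkin_expWord [DecidableEq ι] (x : ι → B) (T : Finset ι) (a : ℝ) (n : ℕ) :
    coeff n (dynkin x (expWord T a)) = if n = 1 then a • ∑ i ∈ T, x i else 0 := by
  cases n with
  | zero => simp [dynkin, dynkinCoeff]
  | succ n => simp [dynkin, expWord, dynkinCoeff_powWord_succ]

/-- Left multiplication by `y` is `ad_y` plus right multiplication, and these two commute: this is
their binomial theorem. -/
theorem sum_ad_pow_mul_pow (y Y : B) (n : ℕ) :
    ∑ k ∈ antidiagonal n,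
      (n.choose k.1 : ℝ) • (((LinearMap.mulLeft ℝ y - LinearMap.mulRight ℝ y) ^ k.1) Y * y ^ k.2)
      = y ^ n * Y := by
  have hc : Commute (LinearMap.mulLeft ℝ y - LinearMap.mulRight ℝ y) (LinearMap.mulRight ℝ y) :=
    (LinearMap.commute_mulLeft_right y y).sub_left (Commute.refl _)
  have h := congrArg (fun f : Module.End ℝ B => f Y) (hc.symm.add_pow' n)
  simp only [add_sub_cancel, LinearMap.pow_mulLeft, LinearMap.mulLeft_apply] at h
  rw [h, LinearMap.sum_apply, ← Nat.sum_antidiagonal_swap]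
  refine sum_congr rfl fun k hk => ?_
  obtain rfl := HasAntidiagonal.mem_antidiagonal.1 hk
  simp only [Prod.fst_swap, Prod.snd_swap, LinearMap.smul_apply, Module.End.mul_apply,
    LinearMap.pow_mulRight, LinearMap.mulRight_apply, Nat.cast_smul_eq_nsmul]
  rw [Nat.choose_symm_add]

theorem isGroupLike_expWord [DecidableEq ι] (x : ι → B) (T : Finset ι) (a : ℝ) :
    IsGroupLike x (expWord T a) where
  nil := by simp [expWord, powWord]
  conj Y := by
    have hs : ∑ i ∈ T, (LinearMap.mulLeft ℝ (x i) - LinearMap.mulRight ℝ (x i))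
        = LinearMap.mulLeft ℝ (∑ i ∈ T, x i) - LinearMap.mulRight ℝ (∑ i ∈ T, x i) := by
      ext; simp [sum_mul, mul_sum]
    ext n
    rw [coeff_mul, coeff_mul]
    simp only [coeff_wordSeries_expWord]
    simp only [adAct, coeff_mk, expWord, wordAct_powWord, hs]
    generalize ∑ i ∈ T, x i = y
    have key (m : ℕ) (Z : B) : (a ^ m / m.factorial) • y ^ m * Z = ∑ k ∈ antidiagonal m,
        ((a ^ k.1 / k.1.factorial) * (a ^ k.2 / k.2.factorial)) •
          (((LinearMap.mulLeft ℝ y - LinearMap.mulRight ℝ y) ^ k.1) Z * y ^ k.2) := by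
      rw [smul_mul_assoc, ← sum_ad_pow_mul_pow, smul_sum]
      refine sum_congr rfl fun k hk => ?_
      rw [← HasAntidiagonal.mem_antidiagonal.1 hk, smul_smul]
      congr 1
      rw [Nat.cast_choose ℝ (Nat.le_add_right _ _), Nat.add_sub_cancel_left, pow_add]
      have := Nat.factorial_ne_zero (k.1 + k.2)
      field_simp
    simp only [key, sum_mul, sum_sigma']
    -- Both sides run over triples (power of `ad y`, degree in `Y`, power of `y`) with different
    -- bracketing. Exchanging the last two entries is an involution matching them.
    refine sum_bij' (fun p _ => ⟨(p.2.1 + p.1.2, p.2.2), (p.2.1, p.1.2)⟩)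
      (fun p _ => ⟨(p.2.1 + p.1.2, p.2.2), (p.2.1, p.1.2)⟩) ?_ ?_ ?_ ?_ ?_
    · rintro ⟨⟨p, q⟩, ⟨r, u⟩⟩ h
      simp only [mem_sigma, HasAntidiagonal.mem_antidiagonal] at h
      simp
      omega
    · rintro ⟨⟨p, q⟩, ⟨r, u⟩⟩ h
      simp only [mem_sigma, HasAntidiagonal.mem_antidiagonal] at h
      simp
      omega
    · rintro ⟨⟨p, q⟩, ⟨r, u⟩⟩ h
      simp only [mem_sigma, HasAntidiagonal.mem_antidiagonal] at h
      simp [h.2]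
    · rintro ⟨⟨p, q⟩, ⟨r, u⟩⟩ h
      simp only [mem_sigma, HasAntidiagonal.mem_antidiagonal] at h
      simp [h.2]
    · rintro ⟨⟨p, q⟩, ⟨r, u⟩⟩ h
      simp only [smul_mul_assoc, mul_smul_comm, smul_smul, mul_comm]
  logDeriv := by
    ext n
    rw [coeff_mul]
    cases n with
    | zero => simp [dynkin_expWord, euler]
    | succ n =>
      rw [sum_eq_single (1, n)]
      · simp only [dynkin_expWord, coeff_wordSeries_expWord, euler, coeff_mk, if_true]
        rw [smul_mul_smul_comm, ← pow_succ', ← Nat.cast_smul_eq_nsmul ℝ, smul_smul]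
        congr 1
        rw [Nat.factorial_succ, pow_succ]
        push_cast
        have := Nat.factorial_ne_zero n
        field_simp
      · rintro ⟨i, j⟩ h hne
        have : i ≠ 1 := by
          rintro rfl
          simp only [HasAntidiagonal.mem_antidiagonal] at h
          exact hne (by simp; omega)
        simp [dynkin_expWord, this]
      · intro h
        exact (h (by simp [add_comm])).elim

/-- The coefficients of order less than `2 n` of a group-like series that agrees with `1` below
order `n` are combinations of nested commutators. -/
theorem IsGroupLike.coeff_eq_dynkin {x : ι → B} {s : List ι → ℝ} (h : IsGroupLike x s) {n : ℕ}
    (hn : ∀ k, 0 < k → k < n → coeff k (wordSeries x s) = 0)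
    (h0 : coeff 0 (wordSeries x s) = 1) (m : ℕ) (hm : m < 2 * n) :
    m • coeff m (wordSeries x s) = dynkinCoeff x s m := by
  induction m using Nat.strong_induction_on with
  | _ m ih =>
    have hl := congrArg (coeff m) h.logDeriv
    simp only [euler, coeff_mk, coeff_mul, dynkin] at hl
    rw [← hl, sum_eq_single (m, 0)]
    · simp [h0]
    · rintro ⟨i, j⟩ hk hne
      rw [HasAntidiagonal.mem_antidiagonal] at hk
      simp only at hk ⊢
      have hj : j ≠ 0 := by
        rintro rfl
        exact hne (by simpa using hk)
      -- As `i + j = m < 2 n`, one of the two indices is below `n`, so the corresponding factor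
      -- vanishes; for `i` this goes through the induction hypothesis.
      by_cases hjn : j < n
      · rw [hn j (by omega) hjn, mul_zero]
      · rw [← ih i (by omega) (by omega)]
        rcases Nat.eq_zero_or_pos i with rfl | hi
        · simp
        · rw [hn i hi (by omega)]; simp
    · simp

end Words

section Formula

variable {ι : Type*} [DecidableEq ι]

/-- The series of the ordered product of the `exp (a X_l)` over a list of letters. -/
def listExpWord (a : ℝ) : List ι → List ι → ℝ
  | [] => expWord ∅ a
  | l :: ls => wordMul (expWord {l} a) (listExpWord a ls)

/-- The noncommutative power series of the product formula at time `a`. -/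
def formulaWord (L : ℕ) : ℕ → ℝ → List (Fin L) → ℝ
  | 0, _ => expWord ∅ 0
  | 1, a => listExpWord a (List.finRange L)
  | 2, a => wordMul (listExpWord (a / 2) (List.finRange L))
      (listExpWord (a / 2) (List.finRange L).reverse)
  | q + 3, a =>
      wordMul
        (wordMul
          (wordMul (formulaWord L (q + 1) (suzukiParam (q + 2) * a))
            (formulaWord L (q + 1) (suzukiParam (q + 2) * a)))
          (formulaWord L (q + 1) ((1 - 4 * suzukiParam (q + 2)) * a)))
        (wordMul (formulaWord L (q + 1) (suzukiParam (q + 2) * a))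
          (formulaWord L (q + 1) (suzukiParam (q + 2) * a)))

/-- The noncommutative power series of `1 + M(t)`, where `M` is the multiplicative error. -/
def errorWord (L p : ℕ) : List (Fin L) → ℝ :=
  wordMul (expWord univ (-1)) (formulaWord L p 1)

/-! ### Bounds on word coefficients, uniform in the number of letters. -/

section Bounds

/-- A word of length `n` has `n + 1` cuts, whatever the size of the alphabet. -/
theorem abs_wordMul_le {ι : Type*} {s s' : List ι → ℝ} {b b' : ℕ → ℝ}
    (h : ∀ w, |s w| ≤ b w.length) (h' : ∀ w, |s' w| ≤ b' w.length) (w : List ι) :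
    |wordMul s s' w| ≤ ∑ k ∈ antidiagonal w.length, b k.1 * b' k.2 := by
  have hmul (v v' : List ι) : |s v * s' v'| ≤ b v.length * b' v'.length := by
    rw [abs_mul]
    exact mul_le_mul (h v) (h' v') (abs_nonneg _) ((abs_nonneg _).trans (h v))
  induction w generalizing s b with
  | nil => simpa [wordMul] using hmul [] []
  | cons i w ih =>
    rw [List.length_cons, Nat.sum_antidiagonal_succ, wordMul, add_comm]
    exact (abs_add_le _ _).trans (add_le_add (hmul [] (i :: w))
      (ih (s := fun v => s (i :: v)) (b := fun n => b (n + 1)) (fun v => h (i :: v))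
        fun v v' => hmul (i :: v) v'))

/-- Only the cut after the maximal initial block of `l` can contribute, since any earlier one leaves
an `l` in the second factor. Hence the bound is not multiplied by the number of cuts and survives a
product of arbitrarily many exponentials. `K` varies because each stripped letter turns it into `K
|a|`. -/
theorem abs_wordMul_powWord_singleton_le {l : ι} {s' : List ι → ℝ} {a : ℝ}
    (h' : ∀ w, |s' w| ≤ |a| ^ w.length) (hl : ∀ w, l ∈ w → s' w = 0) {g : ℕ → ℝ} {K : ℝ}
    (hg : ∀ n, |g n| ≤ K * |a| ^ n) (w : List ι) :
    |wordMul (powWord {l} g) s' w| ≤ K * |a| ^ w.length := by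
  have hK : 0 ≤ K := by simpa using (abs_nonneg _).trans (hg 0)
  have hmul (w : List ι) : |g 0 * s' w| ≤ K * |a| ^ w.length := by
    rw [abs_mul]
    exact mul_le_mul (by simpa using hg 0) (h' w) (abs_nonneg _) hK
  induction w generalizing g K with
  | nil => simpa [wordMul, powWord] using hmul []
  | cons i w ih =>
    rw [wordMul, powWord_cons]
    have h0 : powWord {l} g [] = g 0 := by simp [powWord]
    by_cases hi : i = l
    · subst hi
      have hg' (n : ℕ) : |g (n + 1)| ≤ K * |a| * |a| ^ n := by
        rw [mul_assoc, ← pow_succ']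
        exact hg _
      have hmul' (v : List ι) : |g (0 + 1) * s' v| ≤ K * |a| * |a| ^ v.length := by
        rw [abs_mul]
        exact mul_le_mul (by simpa using hg' 0) (h' v) (abs_nonneg _) (by positivity)
      have := ih (g := fun n => g (n + 1)) hg' (by positivity) hmul'
      rw [hl (i :: w) (by simp)]
      simpa [pow_succ', mul_assoc] using this
    · simpa [hi, wordMul_zero_left, h0] using hmul (i :: w)

theorem wordMul_powWord_singleton_eq_zero {l j : ι} (hlj : j ≠ l) {s' : List ι → ℝ}
    (hj : ∀ w, j ∈ w → s' w = 0) (g : ℕ → ℝ) (w : List ι) (hw : j ∈ w) :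
    wordMul (powWord {l} g) s' w = 0 := by
  induction w generalizing g with
  | nil => simp at hw
  | cons i w ih =>
    rw [wordMul, powWord_cons, hj _ hw, mul_zero, add_zero]
    by_cases hi : i = l
    · subst hi
      have : j ∈ w := by simpa [hlj] using hw
      simpa using ih _ this
    · simp [hi, wordMul_zero_left]

theorem listExpWord_eq_zero (a : ℝ) {ls : List ι} {j : ι} (hj : j ∉ ls) (w : List ι)
    (hw : j ∈ w) : listExpWord a ls w = 0 := by
  induction ls generalizing w with
  | nil => exact if_neg fun h => by simpa using h j hw
  | cons l ls ih =>
    rw [List.mem_cons, not_or] at hj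
    exact wordMul_powWord_singleton_eq_zero hj.1 (fun v hv => ih hj.2 v hv) _ w hw

theorem abs_pow_div_factorial_le (a : ℝ) (n : ℕ) : |a ^ n / n.factorial| ≤ |a| ^ n := by
  rw [abs_div, abs_pow, Nat.abs_cast]
  exact div_le_self (by positivity) (by exact_mod_cast Nat.one_le_iff_ne_zero.2 n.factorial_ne_zero)

theorem abs_expWord_le (T : Finset ι) (a : ℝ) (w : List ι) :
    |expWord T a w| ≤ |a| ^ w.length := by
  unfold expWord powWord
  split_ifs
  · exact abs_pow_div_factorial_le a _
  · simp

theorem abs_listExpWord_le (a : ℝ) {ls : List ι} (h : ls.Nodup) (w : List ι) :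
    |listExpWord a ls w| ≤ |a| ^ w.length := by
  induction ls generalizing w with
  | nil => exact abs_expWord_le ∅ a w
  | cons l ls ih =>
    rw [List.nodup_cons] at h
    simpa [listExpWord, expWord] using abs_wordMul_powWord_singleton_le (K := 1) (ih h.2)
      (fun v hv => listExpWord_eq_zero a h.1 v hv)
      (fun n => by simpa using abs_pow_div_factorial_le a n) w

theorem exists_abs_wordMul_le {s s' : (L : ℕ) → List (Fin L) → ℝ}
    (h : ∃ b : ℕ → ℝ, ∀ (L : ℕ) (w : List (Fin L)), |s L w| ≤ b w.length)
    (h' : ∃ b : ℕ → ℝ, ∀ (L : ℕ) (w : List (Fin L)), |s' L w| ≤ b w.length) :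
    ∃ b : ℕ → ℝ, ∀ (L : ℕ) (w : List (Fin L)), |wordMul (s L) (s' L) w| ≤ b w.length := by
  obtain ⟨b, hb⟩ := h
  obtain ⟨b', hb'⟩ := h'
  exact ⟨fun n => ∑ k ∈ antidiagonal n, b k.1 * b' k.2, fun L w => abs_wordMul_le (hb L) (hb' L) w⟩

/-- The coefficients of the product formula are bounded independently of the number of letters. -/
theorem exists_abs_formulaWord_le :
    ∀ (p : ℕ) (a : ℝ), ∃ b : ℕ → ℝ, ∀ (L : ℕ) (w : List (Fin L)),
      |formulaWord L p a w| ≤ b w.length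
  | 0, _ => ⟨fun n => |0| ^ n, fun _ w => abs_expWord_le ∅ 0 w⟩
  | 1, a => ⟨fun n => |a| ^ n, fun L w => abs_listExpWord_le a (List.nodup_finRange L) w⟩
  | 2, a => exists_abs_wordMul_le
      ⟨fun n => |a / 2| ^ n, fun L w => abs_listExpWord_le (a / 2) (List.nodup_finRange L) w⟩
      ⟨fun n => |a / 2| ^ n, fun L w => abs_listExpWord_le (a / 2)
        (List.nodup_reverse.2 (List.nodup_finRange L)) w⟩
  | q + 3, _ =>
    have h := exists_abs_formulaWord_le (q + 1)
    exists_abs_wordMul_le (exists_abs_wordMul_le (exists_abs_wordMul_le (h _) (h _)) (h _))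
      (exists_abs_wordMul_le (h _) (h _))

theorem exists_abs_errorWord_le (p : ℕ) : ∃ b : ℕ → ℝ, ∀ (L : ℕ) (w : List (Fin L)),
    |errorWord L p w| ≤ b w.length :=
  exists_abs_wordMul_le ⟨fun n => |-1| ^ n, fun _ w => abs_expWord_le univ (-1) w⟩
    (exists_abs_formulaWord_le p 1)

end Bounds

variable {B : Type*} [Ring B] [Algebra ℝ B]

theorem isGroupLike_listExpWord [Fintype ι] (x : ι → B) (a : ℝ) (ls : List ι) :
    IsGroupLike x (listExpWord a ls) := by
  induction ls with
  | nil => exact isGroupLike_expWord x ∅ a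
  | cons l ls ih => exact (isGroupLike_expWord x {l} a).mul ih

theorem isGroupLike_formulaWord {L : ℕ} (x : Fin L → B) :
    ∀ (p : ℕ) (a : ℝ), IsGroupLike x (formulaWord L p a)
  | 0, _ => isGroupLike_expWord x ∅ 0
  | 1, a => isGroupLike_listExpWord x a _
  | 2, _ => (isGroupLike_listExpWord x _ _).mul (isGroupLike_listExpWord x _ _)
  | q + 3, _ =>
    have h := isGroupLike_formulaWord x (q + 1)
    (((h _).mul (h _)).mul (h _)).mul ((h _).mul (h _))

theorem isGroupLike_errorWord {L : ℕ} (x : Fin L → B) (p : ℕ) :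
    IsGroupLike x (errorWord L p) :=
  (isGroupLike_expWord x univ (-1)).mul (isGroupLike_formulaWord x p 1)

/-! ### Order conditions for the product formulas. -/

section Order

/-- The power series `exp (a t y)`. -/
def expSeries (y : B) (a : ℝ) : B⟦X⟧ := PowerSeries.mk fun n => (a ^ n / n.factorial) • y ^ n

theorem wordSeries_expWord [Fintype ι] (x : ι → B) (T : Finset ι) (a : ℝ) :
    wordSeries x (expWord T a) = expSeries (∑ i ∈ T, x i) a := by
  ext n
  rw [coeff_wordSeries_expWord, expSeries, coeff_mk]

theorem coeff_zero_expSeries (y : B) (a : ℝ) : coeff 0 (expSeries y a) = 1 := by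
  simp [expSeries]

theorem expSeries_zero (y : B) : expSeries y 0 = 1 := by
  ext n
  rcases eq_or_ne n 0 with rfl | hn <;> simp_all [expSeries, coeff_one]

theorem expSeries_mul (y : B) (a b : ℝ) :
    expSeries y a * expSeries y b = expSeries y (a + b) := by
  ext n
  simp only [expSeries, coeff_mul, coeff_mk, smul_mul_smul_comm, ← pow_add]
  rw [(Commute.all a b).add_pow', sum_div, sum_smul]
  refine sum_congr rfl fun k hk => ?_
  obtain rfl := HasAntidiagonal.mem_antidiagonal.1 hk
  congr 1
  rw [nsmul_eq_mul, Nat.cast_choose ℝ (Nat.le_add_right _ _), Nat.add_sub_cancel_left]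
  have := Nat.factorial_ne_zero (k.1 + k.2)
  field_simp

/-- `P = exp (a t y) + t ^ n D + O(t ^ (n + 1))`. -/
def IsExpApprox (y : B) (a : ℝ) (n : ℕ) (D : B) (P : B⟦X⟧) : Prop :=
  (∀ k < n, coeff k P = coeff k (expSeries y a)) ∧ coeff n P = coeff n (expSeries y a) + D

/-- In degree `n` each error meets only the constant term of the other factor, which is 1 because `n
≠ 0`; so errors add. -/
theorem IsExpApprox.mul {y : B} {a b : ℝ} {n : ℕ} (hn : n ≠ 0) {D D' : B} {P Q : B⟦X⟧}
    (hP : IsExpApprox y a n D P) (hQ : IsExpApprox y b n D' Q) :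
    IsExpApprox y (a + b) n (D + D') (P * Q) := by
  rw [IsExpApprox, ← expSeries_mul]
  constructor
  · intro k hk
    rw [coeff_mul, coeff_mul]
    refine sum_congr rfl fun m hm => ?_
    have := HasAntidiagonal.mem_antidiagonal.1 hm
    rw [hP.1 _ (by omega), hQ.1 _ (by omega)]
  · have key : ∀ m ∈ antidiagonal n, coeff m.1 P * coeff m.2 Q
        = coeff m.1 (expSeries y a) * coeff m.2 (expSeries y b)
          + ((if m = (n, 0) then D else 0) + if m = (0, n) then D' else 0) := by
      rintro ⟨i, j⟩ hm
      rw [HasAntidiagonal.mem_antidiagonal] at hm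
      simp only at hm ⊢
      rcases Nat.eq_zero_or_pos i with rfl | hi
      · obtain rfl : j = n := by omega
        rw [hP.1 _ (by omega), hQ.2, coeff_zero_expSeries]
        simp [hn, Ne.symm hn]
      · rcases Nat.eq_zero_or_pos j with rfl | hj
        · obtain rfl : i = n := by omega
          rw [hP.2, hQ.1 _ (by omega), coeff_zero_expSeries]
          simp [hn]
        · rw [hP.1 _ (by omega), hQ.1 _ (by omega)]
          simp [hi.ne', hj.ne']
    rw [coeff_mul, coeff_mul, sum_congr rfl key, sum_add_distrib, sum_add_distrib, sum_ite_eq',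
      sum_ite_eq']
    simp

theorem isExpApprox_sub {y : B} {a : ℝ} {n : ℕ} {P : B⟦X⟧}
    (h : ∀ k < n, coeff k P = coeff k (expSeries y a)) :
    IsExpApprox y a n (coeff n P - coeff n (expSeries y a)) P :=
  ⟨h, by abel⟩

theorem IsExpApprox.forall_lt_succ {y : B} {a : ℝ} {n : ℕ} {P : B⟦X⟧}
    (h : IsExpApprox y a n 0 P) : ∀ k < n + 1, coeff k P = coeff k (expSeries y a) := by
  intro k hk
  rcases Nat.lt_succ_iff_lt_or_eq.1 hk with h' | rfl
  · exact h.1 k h'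
  · simpa using h.2

/-- The family `F` of power series is obtained from `F 1` by rescaling the variable. -/
def IsRescaling (F : ℝ → B⟦X⟧) : Prop := ∀ a n, coeff n (F a) = a ^ n • coeff n (F 1)

theorem IsRescaling.mul {F G : ℝ → B⟦X⟧} (hF : IsRescaling F) (hG : IsRescaling G) :
    IsRescaling fun a => F a * G a := by
  intro a n
  simp only [coeff_mul, smul_sum]
  refine sum_congr rfl fun k hk => ?_
  rw [hF a, hG a, smul_mul_smul_comm, ← pow_add, HasAntidiagonal.mem_antidiagonal.1 hk]

theorem IsRescaling.comp_mul {F : ℝ → B⟦X⟧} (hF : IsRescaling F) (c : ℝ) :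
    IsRescaling fun a => F (c * a) := by
  intro a n
  simp only
  rw [hF (c * a), hF (c * 1), smul_smul]
  ring_nf

theorem isRescaling_expSeries (y : B) : IsRescaling (expSeries y) := by
  intro a n
  simp only [expSeries, coeff_mk, smul_smul]
  ring_nf

theorem IsRescaling.isExpApprox {F : ℝ → B⟦X⟧} (hF : IsRescaling F) {y : B} {n : ℕ} {D : B}
    (h : IsExpApprox y 1 n D (F 1)) (a : ℝ) : IsExpApprox y a n (a ^ n • D) (F a) := by
  refine ⟨fun k hk => ?_, ?_⟩
  · rw [hF, h.1 k hk, ← isRescaling_expSeries]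
  · rw [hF, h.2, smul_add, ← isRescaling_expSeries]

/-- A time-symmetric approximation has no error of even order. -/
theorem IsRescaling.coeff_eq_of_even {F : ℝ → B⟦X⟧} (hF : IsRescaling F)
    (hsymm : F 1 * F (-1) = 1) {y : B} {n : ℕ} (hn : Even n) (hn0 : n ≠ 0)
    (h : ∀ k < n, coeff k (F 1) = coeff k (expSeries y 1)) :
    ∀ k < n + 1, coeff k (F 1) = coeff k (expSeries y 1) := by
  have hD := isExpApprox_sub h
  -- Against `exp(ty) exp(-ty) = 1`, the errors `D` and `(-1)^n D` add up to `2 D`, which must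
  -- vanish.
  have hm := (hD.mul hn0 (hF.isExpApprox hD (-1))).2
  rw [hsymm, add_neg_cancel, expSeries_zero, hn.neg_one_pow, one_smul, left_eq_add,
    ← two_smul ℝ, smul_eq_zero] at hm
  rw [hm.resolve_left two_ne_zero] at hD
  exact hD.forall_lt_succ

theorem wordSeries_listExpWord [Fintype ι] (x : ι → B) (a : ℝ) (ls : List ι) :
    wordSeries x (listExpWord a ls) = (ls.map fun l => expSeries (x l) a).prod := by
  induction ls with
  | nil =>
    ext n
    rcases eq_or_ne n 0 with rfl | hn <;>
      simp_all [listExpWord, wordSeries_expWord, expSeries, coeff_one]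
  | cons l ls ih => simp [listExpWord, wordSeries_mul, wordSeries_expWord, ih]

theorem isRescaling_list_prod {ι : Type*} (x : ι → B) (ls : List ι) :
    IsRescaling fun a => (ls.map fun l => expSeries (x l) a).prod := by
  induction ls with
  | nil =>
    intro a n
    rcases eq_or_ne n 0 with rfl | hn <;> simp_all [coeff_one]
  | cons l ls ih => simpa using (isRescaling_expSeries (x l)).mul ih

theorem list_prod_mul_reverse {ι : Type*} (x : ι → B) (ls : List ι) (a : ℝ) :
    (ls.map fun l => expSeries (x l) a).prod
      * (ls.reverse.map fun l => expSeries (x l) (-a)).prod = 1 := by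
  induction ls with
  | nil => simp
  | cons l ls ih =>
    simp only [List.map_cons, List.prod_cons, List.reverse_cons, List.map_append, List.prod_append,
      List.map_nil, List.prod_nil, mul_one]
    rw [mul_assoc, ← mul_assoc _ _ (expSeries (x l) (-a)), ih, one_mul, expSeries_mul,
      add_neg_cancel, expSeries_zero]

theorem isExpApprox_list_prod {ι : Type*} (x : ι → B) (ls : List ι) (a : ℝ) :
    IsExpApprox (ls.map x).sum a 1 0 (ls.map fun l => expSeries (x l) a).prod := by
  induction ls with
  | nil =>
    refine ⟨fun k hk => ?_, by simp [expSeries, coeff_one]⟩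
    obtain rfl : k = 0 := by omega
    simp [expSeries]
  | cons l ls ih =>
    refine ⟨fun k hk => ?_, ?_⟩
    · obtain rfl : k = 0 := by omega
      have := ih.1 0 one_pos
      simp_all [coeff_zero_expSeries, coeff_mul]
    · have h0 := ih.1 0 one_pos
      have h1 := ih.2
      rw [List.map_cons, List.prod_cons, coeff_mul, Nat.antidiagonal_succ]
      simp [h0, h1, coeff_zero_expSeries]
      simp [expSeries, smul_add, add_comm]

/-- With `r = 4^(1/n)` and `s` the parameter, `1 - 4 s = -r s`, whose odd power is `-4 s^n`. For `n
= 1` the denominator `4 - r` would vanish. -/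
theorem four_mul_suzukiParam_pow {n : ℕ} (hn : Odd n) (hn1 : n ≠ 1) :
    4 * suzukiParam n ^ n + (1 - 4 * suzukiParam n) ^ n = 0 := by
  have hn0 : n ≠ 0 := hn.pos.ne'
  set r : ℝ := (4 : ℝ) ^ (1 / (n : ℝ)) with hr
  have hrn : r ^ n = 4 := by
    rw [hr, one_div, Real.rpow_inv_natCast_pow (by norm_num) hn0]
  have hr4 : 4 - r ≠ 0 := by
    intro h
    have h4 : r = 4 := by linarith
    rw [h4] at hrn
    have : (4 : ℝ) ^ 1 < 4 ^ n := pow_lt_pow_right₀ (by norm_num) (by omega)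
    linarith
  have hs : 1 - 4 * suzukiParam n = -(r * suzukiParam n) := by
    rw [suzukiParam, ← hr]
    field_simp
    ring
  rw [hs, hn.neg_pow, mul_pow, hrn]
  ring

/-! ### Suzuki's recursion. -/

section Suzuki

variable {L : ℕ} (x : Fin L → B)

theorem wordSeries_formulaWord_two (a : ℝ) : wordSeries x (formulaWord L 2 a)
    = ((List.finRange L).map fun l => expSeries (x l) (a / 2)).prod
      * ((List.finRange L).reverse.map fun l => expSeries (x l) (a / 2)).prod := by
  rw [formulaWord, wordSeries_mul, wordSeries_listExpWord, wordSeries_listExpWord]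

theorem wordSeries_formulaWord_add_three (q : ℕ) (a : ℝ) :
    wordSeries x (formulaWord L (q + 3) a)
      = wordSeries x (formulaWord L (q + 1) (suzukiParam (q + 2) * a))
        * wordSeries x (formulaWord L (q + 1) (suzukiParam (q + 2) * a))
        * wordSeries x (formulaWord L (q + 1) ((1 - 4 * suzukiParam (q + 2)) * a))
        * (wordSeries x (formulaWord L (q + 1) (suzukiParam (q + 2) * a))
          * wordSeries x (formulaWord L (q + 1) (suzukiParam (q + 2) * a))) := by
  rw [formulaWord]
  simp only [wordSeries_mul]

theorem isRescaling_formulaWord :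
    ∀ p : ℕ, IsRescaling fun a => wordSeries x (formulaWord L p a)
  | 0 => by
    intro a n
    rcases eq_or_ne n 0 with rfl | hn <;>
      simp_all [formulaWord, wordSeries_expWord, expSeries]
  | 1 => by
    simpa only [formulaWord, wordSeries_listExpWord] using isRescaling_list_prod x _
  | 2 => by
    simp only [wordSeries_formulaWord_two, div_eq_inv_mul]
    exact ((isRescaling_list_prod x _).comp_mul _).mul ((isRescaling_list_prod x _).comp_mul _)
  | q + 3 => by
    simp only [wordSeries_formulaWord_add_three]
    have h := isRescaling_formulaWord (q + 1)
    exact (((h.comp_mul _).mul (h.comp_mul _)).mul (h.comp_mul _)).mul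
      ((h.comp_mul _).mul (h.comp_mul _))

/-- Palindromic products of factors inverted by time reversal are again inverted by time reversal.
-/
theorem wordSeries_formulaWord_mul_neg :
    ∀ (p : ℕ) (_ : Even p) (a : ℝ),
      wordSeries x (formulaWord L p a) * wordSeries x (formulaWord L p (-a)) = 1
  | 0, _, a => by simp [formulaWord, wordSeries_expWord, expSeries_zero]
  | 1, h, _ => by simp at h
  | 2, _, a => by
    have h₁ := list_prod_mul_reverse x (List.finRange L) (a / 2)
    have h₂ := list_prod_mul_reverse x (List.finRange L).reverse (a / 2)
    rw [List.reverse_reverse] at h₂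
    rw [wordSeries_formulaWord_two, wordSeries_formulaWord_two, neg_div, mul_assoc,
      ← mul_assoc _ _ (List.map _ (List.finRange L).reverse).prod, h₂, one_mul, h₁]
  | q + 3, hq, a => by
    have h := wordSeries_formulaWord_mul_neg (q + 1) (by
      have : Even (q + 1 + 2) := hq
      simpa [Nat.even_add] using this)
    rw [wordSeries_formulaWord_add_three, wordSeries_formulaWord_add_three, mul_neg, mul_neg]
    have hu := h (suzukiParam (q + 2) * a)
    have hv := h ((1 - 4 * suzukiParam (q + 2)) * a)
    generalize wordSeries x (formulaWord L (q + 1) (suzukiParam (q + 2) * a)) = u at *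
    generalize wordSeries x (formulaWord L (q + 1) (-(suzukiParam (q + 2) * a))) = u' at *
    generalize wordSeries x (formulaWord L (q + 1) ((1 - 4 * suzukiParam (q + 2)) * a)) = v at *
    generalize wordSeries x (formulaWord L (q + 1) (-((1 - 4 * suzukiParam (q + 2)) * a))) = v'
      at *
    have huu : u * u * (u' * u') = 1 := by
      rw [mul_assoc, ← mul_assoc u u', hu, one_mul, hu]
    calc u * u * v * (u * u) * (u' * u' * v' * (u' * u'))
        = u * u * (v * (u * u * (u' * u')) * v') * (u' * u') := by noncomm_ring
      _ = 1 := by rw [huu, mul_one, hv, mul_one, huu]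

/-- The product formula of order `p` agrees with the exponential up to order `p`. -/
theorem coeff_wordSeries_formulaWord :
    ∀ p : ℕ, (p = 1 ∨ 2 ≤ p ∧ Even p) → ∀ k < p + 1,
      coeff k (wordSeries x (formulaWord L p 1)) = coeff k (expSeries (∑ l, x l) 1)
  | 0, h => by simp at h
  | 1, _ => by
    have h := isExpApprox_list_prod x (List.finRange L) 1
    rw [← List.ofFn_eq_map, List.sum_ofFn] at h
    simpa only [formulaWord, wordSeries_listExpWord] using h.forall_lt_succ
  | 2, _ => by
    have hR : (List.finRange L).reverse.map x = ((List.finRange L).map x).reverse := by simp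
    have h₁ := isExpApprox_list_prod x (List.finRange L) (1 / 2)
    have h₂ := isExpApprox_list_prod x (List.finRange L).reverse (1 / 2)
    rw [hR, List.sum_reverse] at h₂
    have h := h₁.mul one_ne_zero h₂
    rw [← wordSeries_formulaWord_two, add_zero, add_halves] at h
    refine (isRescaling_formulaWord x 2).coeff_eq_of_even
      (wordSeries_formulaWord_mul_neg x 2 even_two 1) even_two two_ne_zero ?_
    rw [← List.ofFn_eq_map, List.sum_ofFn] at h
    exact h.forall_lt_succ
  | q + 3, hq => by
    have hq3 : Even (q + 3) := by
      rcases hq with h | h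
      · omega
      · exact h.2
    have hq1 : Even (q + 1) := by
      have : Even (q + 1 + 2) := hq3
      simpa [Nat.even_add] using this
    have hq2 : Odd (q + 2) := hq1.add_one
    have hq0 : q + 1 ≠ 1 := by
      intro h
      rw [h] at hq1
      simp at hq1
    have ih := isExpApprox_sub (coeff_wordSeries_formulaWord (q + 1)
      (Or.inr ⟨by omega, hq1⟩))
    have hu := (isRescaling_formulaWord x (q + 1)).isExpApprox ih
    have hn : q + 1 + 1 ≠ 0 := by omega
    -- The recursion gains two orders: Suzuki's parameter removes the error of odd degree `q + 2`,
    -- and time symmetry then removes degree `q + 3`.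
    refine (isRescaling_formulaWord x (q + 3)).coeff_eq_of_even
      (wordSeries_formulaWord_mul_neg x (q + 3) hq3 1) hq3 (by omega) ?_
    rw [wordSeries_formulaWord_add_three]
    set s := suzukiParam (q + 2) with hs
    have h5 := (((hu (s * 1)).mul hn (hu (s * 1))).mul hn (hu ((1 - 4 * s) * 1))).mul hn
      ((hu (s * 1)).mul hn (hu (s * 1)))
    simp only [← add_smul] at h5
    rw [show s * 1 + s * 1 + (1 - 4 * s) * 1 + (s * 1 + s * 1) = 1 by ring,
      show (s * 1) ^ (q + 1 + 1) + (s * 1) ^ (q + 1 + 1) + ((1 - 4 * s) * 1) ^ (q + 1 + 1)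
        + ((s * 1) ^ (q + 1 + 1) + (s * 1) ^ (q + 1 + 1)) = 0 by
          rw [← four_mul_suzukiParam_pow hq2 (by omega), ← hs]
          ring, zero_smul] at h5
    exact h5.forall_lt_succ

theorem coeff_wordSeries_errorWord {p : ℕ} (hp : p = 1 ∨ 2 ≤ p ∧ Even p) {k : ℕ}
    (hk : k < p + 1) :
    coeff k (wordSeries x (errorWord L p)) = coeff k (1 : B⟦X⟧) := by
  rw [← expSeries_zero (∑ l, x l), ← neg_add_cancel (1 : ℝ), ← expSeries_mul, errorWord,
    wordSeries_mul, wordSeries_expWord, coeff_mul, coeff_mul]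
  refine sum_congr rfl fun m hm => ?_
  have := HasAntidiagonal.mem_antidiagonal.1 hm
  rw [coeff_wordSeries_formulaWord x p hp _ (by omega)]

end Suzuki

end Order

end Formula

/-! ### Dynkin coefficients as sums of nested commutators. -/

section NestedCommutators

variable {A : Type*} [NormedRing A] [NormedAlgebra ℂ A]

theorem sum_fin_succ_arrow {ι M : Type*} [Fintype ι] [AddCommMonoid M] (n : ℕ)
    (f : (Fin (n + 1) → ι) → M) :
    ∑ l, f l = ∑ i, ∑ l : Fin n → ι, f (Fin.cons i l) := by
  rw [← (Fin.consEquiv fun _ => ι).sum_comp, Fintype.sum_prod_type]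
  rfl

theorem dynkinCoeff_succ {ι : Type*} [Fintype ι] (x : ι → A) (s : List ι → ℝ) (n : ℕ) :
    dynkinCoeff x s (n + 1)
      = ∑ l : Fin (n + 1) → ι, s (List.ofFn l) • nestedComm n fun i => x (l i) := by
  induction n generalizing s with
  | zero => simp [dynkinCoeff, sum_fin_succ_arrow, nestedComm, Ring.lie_def]
  | succ n ih =>
    rw [dynkinCoeff, sum_fin_succ_arrow]
    refine sum_congr rfl fun i _ => ?_
    rw [ih, if_neg n.succ_ne_zero, zero_smul, zero_add, Ring.lie_def, mul_sum, sum_mul,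
      ← sum_sub_distrib]
    refine sum_congr rfl fun l _ => ?_
    rw [mul_smul_comm, smul_mul_assoc, ← smul_sub,
      List.ofFn_succ (f := Fin.cons i l)]
    rfl

theorem nestedComm_smul (c : ℂ) (n : ℕ) (Y : Fin (n + 1) → A) :
    (nestedComm n fun i => c • Y i) = c ^ (n + 1) • nestedComm n Y := by
  induction n with
  | zero => simp [nestedComm]
  | succ n ih =>
    have h : (Fin.tail fun i => c • Y i) = fun i => c • Fin.tail Y i := rfl
    rw [nestedComm, nestedComm, h, ih, Ring.lie_def, Ring.lie_def, smul_mul_smul_comm,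
      smul_mul_smul_comm, ← pow_succ', ← pow_succ, ← smul_sub]

theorem norm_nestedComm_neg_I_smul (n : ℕ) (Y : Fin (n + 1) → A) :
    ‖nestedComm n fun i => (-Complex.I) • Y i‖ = ‖nestedComm n Y‖ := by
  rw [nestedComm_smul, norm_smul]
  simp

theorem norm_dynkinCoeff_le {L : ℕ} (H : Fin L → A) {s : List (Fin L) → ℝ} {b : ℝ} (n : ℕ)
    (hb : ∀ w : List (Fin L), w.length = n + 1 → |s w| ≤ b) :
    ‖dynkinCoeff (fun l => (-Complex.I) • H l) s (n + 1)‖ ≤ b * commNormSum H n := by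
  rw [dynkinCoeff_succ, commNormSum, mul_sum]
  refine norm_sum_le_of_le _ fun l _ => ?_
  rw [norm_smul, Real.norm_eq_abs]
  refine mul_le_mul (hb _ (by simp)) (norm_nestedComm_neg_I_smul n fun i => H (l i)).le
    (norm_nonneg _) ((abs_nonneg _).trans (hb (List.ofFn l) (by simp)))

theorem nestedComm_eq_zero_of_le {A : Type*} [NormedRing A] {L : ℕ} (H : Fin L → A) {m n : ℕ} (hmn : m ≤ n)
    (h : ∀ l : Fin (m + 1) → Fin L, (nestedComm m fun i => H (l i)) = 0)
    (l : Fin (n + 1) → Fin L) : (nestedComm n fun i => H (l i)) = 0 := by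
  induction n, hmn using Nat.le_induction with
  | base => exact h l
  | succ n _ ih =>
    rw [nestedComm]
    have : nestedComm n (Fin.tail fun i => H (l i)) = 0 := ih (Fin.tail l)
    simp [this, Ring.lie_def]

end NestedCommutators

/-! ### From formal to convergent power series. -/

section PowerSum

variable {A : Type*} [NormedRing A] [NormedAlgebra ℂ A]

/-- `f` is the everywhere absolutely convergent sum of the power series `P`. -/
def HasPowerSum (f : ℝ → A) (P : A⟦X⟧) : Prop :=
  ∀ t : ℝ, Summable (fun n => ‖t ^ n • coeff n P‖) ∧ f t = ∑' n, t ^ n • coeff n P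

theorem hasPowerSum_one : HasPowerSum (fun _ => (1 : A)) 1 := by
  intro t
  have h : ∀ n, n ≠ 0 → t ^ n • coeff n (1 : A⟦X⟧) = 0 := fun n hn => by simp [coeff_one, hn]
  refine ⟨summable_of_ne_finset_zero (s := {0}) fun n hn => ?_, ?_⟩
  · rw [h n (by simpa using hn), norm_zero]
  · rw [tsum_eq_single 0 h]
    simp

theorem evolution_eq_exp (h : A) (t : ℝ) :
    evolution h t = NormedSpace.exp (t • ((-Complex.I) • h)) := by
  rw [evolution, ← Complex.coe_smul, smul_smul]
  congr 2
  ring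

theorem hasPowerSum_evolution (h : A) (a : ℝ) :
    HasPowerSum (fun t => evolution h (a * t)) (expSeries ((-Complex.I) • h) a) := by
  intro t
  have key (n : ℕ) : t ^ n • coeff n (expSeries ((-Complex.I) • h) a)
      = ((n.factorial : ℝ)⁻¹) • ((a * t) • ((-Complex.I) • h)) ^ n := by
    rw [expSeries, coeff_mk, smul_pow (a * t), smul_smul, smul_smul]
    congr 1
    rw [mul_pow]
    ring
  simp only [key]
  refine ⟨NormedSpace.norm_expSeries_summable' _, ?_⟩
  rw [evolution_eq_exp, NormedSpace.exp_eq_tsum ℝ]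

variable [CompleteSpace A]

theorem HasPowerSum.mul {f g : ℝ → A} {P Q : A⟦X⟧} (hf : HasPowerSum f P)
    (hg : HasPowerSum g Q) : HasPowerSum (fun t => f t * g t) (P * Q) := by
  intro t
  have key (n : ℕ) : t ^ n • coeff n (P * Q)
      = ∑ k ∈ antidiagonal n, (t ^ k.1 • coeff k.1 P) * (t ^ k.2 • coeff k.2 Q) := by
    rw [coeff_mul, smul_sum]
    refine sum_congr rfl fun k hk => ?_
    rw [smul_mul_smul_comm, ← pow_add, HasAntidiagonal.mem_antidiagonal.1 hk]
  have hs := summable_norm_sum_mul_antidiagonal_of_summable_norm (hf t).1 (hg t).1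
  have hm := tsum_mul_tsum_eq_tsum_sum_antidiagonal_of_summable_norm (hf t).1 (hg t).1
  refine ⟨hs.congr fun n => by rw [key], ?_⟩
  simp only [(hf t).2, (hg t).2, hm, key]

theorem hasPowerSum_list_prod {ι : Type*} (H : ι → A) (a : ℝ) (ls : List ι) :
    HasPowerSum (fun t => (ls.map fun l => evolution (H l) (a * t)).prod)
      (ls.map fun l => expSeries ((-Complex.I) • H l) a).prod := by
  induction ls with
  | nil => simpa using hasPowerSum_one
  | cons l ls ih => simpa using (hasPowerSum_evolution (H l) a).mul ih

theorem hasPowerSum_productFormula {L : ℕ} (H : Fin L → A) :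
    ∀ (p : ℕ) (a : ℝ), HasPowerSum (fun t => productFormula H p (a * t))
      (wordSeries (fun l => (-Complex.I) • H l) (formulaWord L p a))
  | 0, a => by
    simpa [productFormula, formulaWord, wordSeries_expWord, expSeries_zero] using hasPowerSum_one
  | 1, a => by
    simpa only [productFormula, forwardProd, formulaWord, wordSeries_listExpWord,
      List.ofFn_eq_map] using hasPowerSum_list_prod H a (List.finRange L)
  | 2, a => by
    have h (t : ℝ) : a * t / 2 = a / 2 * t := by ring
    simpa only [productFormula, forwardProd, backwardProd, wordSeries_formulaWord_two,
      List.ofFn_eq_map, h, List.map_reverse] using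
      (hasPowerSum_list_prod H (a / 2) (List.finRange L)).mul
        (hasPowerSum_list_prod H (a / 2) (List.finRange L).reverse)
  | q + 3, a => by
    have h := hasPowerSum_productFormula H (q + 1)
    simp only [productFormula, wordSeries_formulaWord_add_three, pow_two, ← mul_assoc _ a]
    exact (((h _).mul (h _)).mul (h _)).mul ((h _).mul (h _))

theorem hasPowerSum_one_add_multError {L : ℕ} (H : Fin L → A) (p : ℕ) :
    HasPowerSum (fun t => 1 + multError H p t)
      (wordSeries (fun l => (-Complex.I) • H l) (errorWord L p)) := by
  rw [errorWord, wordSeries_mul, wordSeries_expWord, ← smul_sum]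
  simpa [multError] using
    (hasPowerSum_evolution (∑ l, H l) (-1)).mul (hasPowerSum_productFormula H p 1)

theorem HasPowerSum.exists_norm_sub_le {f : ℝ → A} {P : A⟦X⟧} (h : HasPowerSum f P) (N : ℕ) :
    ∃ K : ℝ, ∀ t : ℝ, 0 ≤ t → t ≤ 1 →
      ‖f t - ∑ n ∈ range N, t ^ n • coeff n P‖ ≤ K * t ^ N := by
  have h1 : Summable fun n => ‖coeff (n + N) P‖ := by
    simpa using (summable_nat_add_iff N).2 (h 1).1
  -- The constant is the absolute tail at `t = 1`, which dominates the tail on `[0, 1]` after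
  -- factoring out `t ^ N`.
  refine ⟨∑' n, ‖coeff (n + N) P‖, fun t ht0 ht1 => ?_⟩
  have hs : Summable fun n => t ^ n • coeff n P := (h t).1.of_norm
  rw [(h t).2, ← hs.sum_add_tsum_nat_add N, add_sub_cancel_left, ← tsum_mul_right]
  refine tsum_of_norm_bounded (h1.mul_right _).hasSum fun n => ?_
  rw [norm_smul, norm_pow, Real.norm_of_nonneg ht0, pow_add, mul_comm]
  refine mul_le_mul_of_nonneg_left ?_ (norm_nonneg _)
  exact mul_le_of_le_one_left (by positivity) (pow_le_one₀ ht0 ht1)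

end PowerSum

/-! ### Unitarity, and double commutators with a self-adjoint element. -/

section Unitary

variable {A : Type*} [NormedRing A] [NormedAlgebra ℂ A]

theorem evolution_zero (h : A) : evolution h 0 = 1 := by
  simp [evolution]

variable [CompleteSpace A]

theorem evolution_add (h : A) (s t : ℝ) :
    evolution h (s + t) = evolution h s * evolution h t := by
  let _ : NormedAlgebra ℚ A := NormedAlgebra.restrictScalars ℚ ℂ A
  simp only [evolution_eq_exp, add_smul]
  exact NormedSpace.exp_add_of_commute (((Commute.refl _).smul_left _).smul_right _)

theorem evolution_mul_neg (h : A) (t : ℝ) : evolution h t * evolution h (-t) = 1 := by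
  rw [← evolution_add, add_neg_cancel, evolution_zero]

/-- The expansion of the conjugated `Y` in powers of `ad_h` stops after the linear term.
Equivalently, undoing the conjugation on `Y + u W` gives a function of `u` with zero derivative. -/
theorem evolution_mul_mul_neg {h Y : A} (hcomm : ⁅h, ⁅h, Y⁆⁆ = 0) (t : ℝ) :
    evolution h t * Y * evolution h (-t) = Y + t • ((-Complex.I) • ⁅h, Y⁆) := by
  set x : A := (-Complex.I) • h with hx
  set W : A := (-Complex.I) • ⁅h, Y⁆ with hW
  have hW1 : W = x * Y - Y * x := by
    rw [hW, hx, Ring.lie_def, smul_sub, smul_mul_assoc, mul_smul_comm]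
  have hW2 : x * W - W * x = 0 := by
    rw [Ring.lie_def] at hcomm
    rw [hW, hx, smul_mul_smul_comm, smul_mul_smul_comm, ← smul_sub, hcomm, smul_zero]
  have hd (u : ℝ) : HasDerivAt
      (fun u : ℝ => evolution h (-u) * (Y + u • W) * evolution h u) 0 u := by
    have h1 : HasDerivAt (fun u : ℝ => evolution h u) (x * evolution h u) u := by
      simpa only [evolution_eq_exp] using hasDerivAt_exp_smul_const' x u
    have h2 : HasDerivAt (fun u : ℝ => evolution h (-u)) (-(evolution h (-u) * x)) u := by
      have h3 : HasDerivAt (fun u : ℝ => evolution h u) (evolution h (-u) * x) (-u) := by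
        simpa only [evolution_eq_exp] using hasDerivAt_exp_smul_const x (-u)
      simpa [Function.comp_def] using h3.scomp u (hasDerivAt_neg u)
    have h4 : HasDerivAt (fun u : ℝ => Y + u • W) W u := by
      simpa using ((hasDerivAt_id u).smul_const W).const_add Y
    have h5 : -(x * (Y + u • W)) + W + (Y + u • W) * x = 0 := by
      have : -(x * (Y + u • W)) + W + (Y + u • W) * x
          = W - (x * Y - Y * x) - u • (x * W - W * x) := by
        rw [mul_add, add_mul, mul_smul_comm, smul_mul_assoc u W x, smul_sub]
        abel
      rw [this, hW2, ← hW1, sub_self, smul_zero, sub_zero]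
    refine ((h2.mul h4).mul h1).congr_deriv ?_
    simp only [Pi.mul_apply]
    generalize Y + u • W = V at h5 ⊢
    calc (-(evolution h (-u) * x) * V + evolution h (-u) * W) * evolution h u
          + evolution h (-u) * V * (x * evolution h u)
        = evolution h (-u) * (-(x * V) + W + V * x) * evolution h u := by
          noncomm_ring
      _ = 0 := by rw [h5]; simp
  have hc := is_const_of_deriv_eq_zero (fun u => (hd u).differentiableAt) (fun u => (hd u).deriv)
    t 0
  simp only [neg_zero, evolution_zero, zero_smul, add_zero, one_mul, mul_one] at hc
  calc evolution h t * Y * evolution h (-t)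
      = (evolution h t * evolution h (-t)) * (Y + t • W)
          * (evolution h t * evolution h (-t)) := by
        nth_rw 1 [← hc]
        simp only [mul_assoc]
    _ = Y + t • W := by rw [evolution_mul_neg, one_mul, mul_one]

variable [StarRing A] [CStarRing A] [StarModule ℂ A]

theorem evolution_mem_unitary {h : A} (hh : IsSelfAdjoint h) (t : ℝ) :
    evolution h t ∈ unitary A := by
  let _ : NormedAlgebra ℚ A := NormedAlgebra.restrictScalars ℚ ℂ A
  refine NormedSpace.exp_mem_unitary_of_mem_skewAdjoint ?_
  rw [skewAdjoint.mem_iff, star_smul, hh.star_eq, ← neg_smul]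
  simp

/-- The unitary orbit of `Y` is affine in `t` and has constant norm, so its slope is zero. -/
theorem lie_eq_zero_of_lie_lie_eq_zero {h : A} (hh : IsSelfAdjoint h) {Y : A}
    (hcomm : ⁅h, ⁅h, Y⁆⁆ = 0) : ⁅h, Y⁆ = 0 := by
  have key (t : ℝ) (ht : 0 < t) : t * ‖⁅h, Y⁆‖ ≤ 2 * ‖Y‖ := by
    have h1 : ‖Y + t • ((-Complex.I) • ⁅h, Y⁆)‖ = ‖Y‖ := by
      rw [← evolution_mul_mul_neg hcomm,
        CStarRing.norm_mul_mem_unitary _ (evolution_mem_unitary hh _),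
        CStarRing.norm_mem_unitary_mul _ (evolution_mem_unitary hh _)]
    have h2 : ‖t • ((-Complex.I) • ⁅h, Y⁆)‖ = t * ‖⁅h, Y⁆‖ := by
      rw [norm_smul, norm_smul, Real.norm_of_nonneg ht.le]
      simp
    have h3 := norm_sub_le (Y + t • ((-Complex.I) • ⁅h, Y⁆)) Y
    rw [add_sub_cancel_left, h1, h2] at h3
    linarith
  by_contra hne
  have hpos : 0 < ‖⁅h, Y⁆‖ := norm_pos_iff.2 hne
  have := key ((2 * ‖Y‖ + 1) / ‖⁅h, Y⁆‖) (by positivity)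
  rw [div_mul_cancel₀ _ hpos.ne'] at this
  linarith

theorem productFormula_mem_unitary {L : ℕ} {H : Fin L → A} (hH : ∀ l, IsSelfAdjoint (H l)) :
    ∀ (p : ℕ) (t : ℝ), productFormula H p t ∈ unitary A
  | 0, _ => one_mem _
  | 1, t => by
    refine Submonoid.list_prod_mem _ fun y hy => ?_
    obtain ⟨l, rfl⟩ := List.mem_ofFn.1 hy
    exact evolution_mem_unitary (hH l) t
  | 2, t => by
    refine mul_mem (Submonoid.list_prod_mem _ fun y hy => ?_)
      (Submonoid.list_prod_mem _ fun y hy => ?_)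
    · obtain ⟨l, rfl⟩ := List.mem_ofFn.1 hy
      exact evolution_mem_unitary (hH l) _
    · obtain ⟨l, rfl⟩ := List.mem_ofFn.1 (List.mem_reverse.1 hy)
      exact evolution_mem_unitary (hH l) _
  | q + 3, t => by
    have h := productFormula_mem_unitary hH (q + 1)
    exact mul_mem (mul_mem (pow_mem (h _) 2) (h _)) (pow_mem (h _) 2)

end Unitary

/-- The coefficients of the leading error term of the product formula. -/
def leadingCoeff (L p : ℕ) (l : Fin (p + 1) → Fin L) : ℝ :=
  errorWord L p (List.ofFn l) / (p + 1)

/-! ### The leading term and the remainder of the multiplicative error. -/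

section Remainder

variable {A : Type*} [NormedRing A] [NormedAlgebra ℂ A]

theorem coeff_zero_wordSeries_errorWord {L : ℕ} (x : Fin L → A) {p : ℕ}
    (hp : p = 1 ∨ 2 ≤ p ∧ Even p) : coeff 0 (wordSeries x (errorWord L p)) = 1 := by
  rw [coeff_wordSeries_errorWord x hp (by omega), coeff_zero_one]

theorem coeff_wordSeries_errorWord_eq_zero {L : ℕ} (x : Fin L → A) {p : ℕ}
    (hp : p = 1 ∨ 2 ≤ p ∧ Even p) {k : ℕ} (hk : 0 < k) (hkp : k < p + 1) :
    coeff k (wordSeries x (errorWord L p)) = 0 := by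
  rw [coeff_wordSeries_errorWord x hp hkp, coeff_one, if_neg hk.ne']

theorem nsmul_coeff_wordSeries_errorWord {L : ℕ} (x : Fin L → A) {p : ℕ}
    (hp : p = 1 ∨ 2 ≤ p ∧ Even p) {m : ℕ} (hm : m < 2 * (p + 1)) :
    (m : ℝ) • coeff m (wordSeries x (errorWord L p)) = dynkinCoeff x (errorWord L p) m := by
  rw [Nat.cast_smul_eq_nsmul]
  exact (isGroupLike_errorWord x p).coeff_eq_dynkin
    (fun _ => coeff_wordSeries_errorWord_eq_zero x hp) (coeff_zero_wordSeries_errorWord x hp) m hm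

/-- The leading coefficient of the multiplicative error. -/
theorem coeff_wordSeries_errorWord_eq_commComb {L : ℕ} (H : Fin L → A) {p : ℕ}
    (hp : p = 1 ∨ 2 ≤ p ∧ Even p) :
    coeff (p + 1) (wordSeries (fun l => (-Complex.I) • H l) (errorWord L p))
      = commComb H p (leadingCoeff L p) := by
  have h := nsmul_coeff_wordSeries_errorWord (fun l => (-Complex.I) • H l) hp
    (show p + 1 < 2 * (p + 1) by omega)
  have hp1 : ((p + 1 : ℕ) : ℝ) ≠ 0 := by positivity
  refine smul_right_injective A hp1 ?_
  simp only [h, dynkinCoeff_succ, commComb, smul_sum]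
  refine sum_congr rfl fun l _ => ?_
  rw [Complex.coe_smul, smul_smul, leadingCoeff]
  congr 1
  push_cast at hp1 ⊢
  field_simp

theorem norm_coeff_wordSeries_errorWord_le {L : ℕ} (H : Fin L → A) {p : ℕ}
    (hp : p = 1 ∨ 2 ≤ p ∧ Even p) {b : ℝ}
    (hb : ∀ w : List (Fin L), w.length = p + 2 → |errorWord L p w| ≤ b) :
    ‖coeff (p + 2) (wordSeries (fun l => (-Complex.I) • H l) (errorWord L p))‖
      ≤ b * commNormSum H (p + 1) := by
  -- Since `p ≥ 1`, degree `p + 2` still lies in the range of the Dynkin identity; the gained factor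
  -- `1 / (p + 2)` is dropped.
  have h := nsmul_coeff_wordSeries_errorWord (fun l => (-Complex.I) • H l) hp
    (show p + 2 < 2 * (p + 1) by omega)
  refine le_trans ?_ (norm_dynkinCoeff_le H (p + 1) hb)
  rw [← h, norm_smul, Real.norm_of_nonneg (by positivity)]
  refine le_mul_of_one_le_left (norm_nonneg _) ?_
  push_cast
  linarith [(Nat.cast_nonneg p : (0 : ℝ) ≤ p)]

theorem commComb_eq_zero {L : ℕ} (H : Fin L → A) {p : ℕ}
    (h : ∀ l : Fin (p + 1) → Fin L, (nestedComm p fun i => H (l i)) = 0)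
    (c : (Fin (p + 1) → Fin L) → ℝ) : commComb H p c = 0 :=
  sum_eq_zero fun l _ => by
    rw [nestedComm_smul (-Complex.I) p fun i => H (l i), h, smul_zero, smul_zero]

variable [CompleteSpace A]

theorem exists_norm_multError_sub_le {L : ℕ} (H : Fin L → A) {p : ℕ}
    (hp : p = 1 ∨ 2 ≤ p ∧ Even p) {b : ℝ}
    (hb : ∀ w : List (Fin L), w.length = p + 2 → |errorWord L p w| ≤ b) :
    ∃ K : ℝ, ∀ t : ℝ, 0 ≤ t → t ≤ 1 →
      ‖multError H p t - t ^ (p + 1) • commComb H p (leadingCoeff L p)‖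
        ≤ b * commNormSum H (p + 1) * t ^ (p + 2) + K * t ^ (p + 3) := by
  obtain ⟨K, hK⟩ := (hasPowerSum_one_add_multError H p).exists_norm_sub_le (p + 3)
  refine ⟨K, fun t ht0 ht1 => ?_⟩
  have h := hK t ht0 ht1
  set P := wordSeries (fun l => (-Complex.I) • H l) (errorWord L p) with hP
  have hlow : ∑ n ∈ range (p + 1), t ^ n • coeff n P = 1 := by
    rw [sum_range_succ', sum_eq_zero, coeff_zero_wordSeries_errorWord _ hp]
    · simp
    · intro n hn
      rw [coeff_wordSeries_errorWord_eq_zero _ hp n.succ_pos (by simpa using hn), smul_zero]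
  rw [sum_range_succ, sum_range_succ, hlow, coeff_wordSeries_errorWord_eq_commComb H hp] at h
  have hn : ‖t ^ (p + 2) • coeff (p + 2) P‖ ≤ b * commNormSum H (p + 1) * t ^ (p + 2) := by
    rw [norm_smul, Real.norm_of_nonneg (by positivity), mul_comm]
    exact mul_le_mul_of_nonneg_right (norm_coeff_wordSeries_errorWord_le H hp hb) (by positivity)
  calc ‖multError H p t - t ^ (p + 1) • commComb H p (leadingCoeff L p)‖
      = ‖t ^ (p + 2) • coeff (p + 2) P + (1 + multError H p t
          - (1 + t ^ (p + 1) • commComb H p (leadingCoeff L p)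
            + t ^ (p + 2) • coeff (p + 2) P))‖ := by
        congr 1
        abel
    _ ≤ _ := (norm_add_le _ _).trans (add_le_add hn h)

/-- The Dynkin series vanishes in low degrees by the order conditions and in higher ones because
longer nests contain the vanishing ones. So the logarithmic derivative is zero and the series is
constant. -/
theorem multError_eq_zero {L : ℕ} (H : Fin L → A) {p : ℕ} (hp : p = 1 ∨ 2 ≤ p ∧ Even p)
    (h : ∀ l : Fin (p + 1) → Fin L, (nestedComm p fun i => H (l i)) = 0) (t : ℝ) :
    multError H p t = 0 := by
  set x : Fin L → A := fun l => (-Complex.I) • H l with hx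
  have hd : dynkin x (errorWord L p) = 0 := by
    ext m
    rw [dynkin, coeff_mk, map_zero]
    rcases lt_or_ge m (p + 1) with hm | hm
    · rw [← nsmul_coeff_wordSeries_errorWord x hp (by omega)]
      rcases Nat.eq_zero_or_pos m with rfl | hm0
      · simp
      · rw [coeff_wordSeries_errorWord_eq_zero x hp hm0 hm, smul_zero]
    · obtain ⟨n, rfl⟩ : ∃ n, m = n + 1 := ⟨m - 1, by omega⟩
      rw [dynkinCoeff_succ]
      refine sum_eq_zero fun l _ => ?_
      rw [nestedComm_smul (-Complex.I) n fun i => H (l i),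
        nestedComm_eq_zero_of_le H (by omega) h, smul_zero, smul_zero]
  have hl := (isGroupLike_errorWord x p).logDeriv
  rw [hd, zero_mul] at hl
  have hc (m : ℕ) (hm : m ≠ 0) : coeff m (wordSeries x (errorWord L p)) = 0 := by
    have := congrArg (coeff m) hl
    rw [map_zero, euler, coeff_mk, ← Nat.cast_smul_eq_nsmul ℝ, eq_comm, smul_eq_zero] at this
    exact this.resolve_left (by exact_mod_cast hm)
  have ht := (hasPowerSum_one_add_multError H p t).2
  rw [tsum_eq_single 0 fun m hm => by rw [hc m hm, smul_zero],
    coeff_zero_wordSeries_errorWord _ hp] at ht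
  simpa using ht

variable [StarRing A] [CStarRing A] [StarModule ℂ A]

theorem nestedComm_eq_zero_of_commNormSum_eq_zero {L : ℕ} {H : Fin L → A}
    (hH : ∀ l, IsSelfAdjoint (H l)) {p : ℕ} (hp : p ≠ 0) (h : commNormSum H (p + 1) = 0)
    (l : Fin (p + 1) → Fin L) : (nestedComm p fun i => H (l i)) = 0 := by
  obtain ⟨q, rfl⟩ := Nat.exists_eq_succ_of_ne_zero hp
  refine lie_eq_zero_of_lie_lie_eq_zero (hH (l 0)) ?_
  rw [commNormSum, sum_eq_zero_iff_of_nonneg fun _ _ => norm_nonneg _] at h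
  -- Repeating the outermost letter gives a term of `α_{p+2}` that is a double commutator with `H (l
  -- 0)`.
  exact norm_eq_zero.1 (h (Fin.cons (l 0) l) (mem_univ _))

theorem exists_norm_multError_sub_le_of_isSelfAdjoint {L : ℕ} {H : Fin L → A}
    (hH : ∀ l, IsSelfAdjoint (H l)) {p : ℕ} (hp : p = 1 ∨ 2 ≤ p ∧ Even p) {b : ℝ}
    (hb : ∀ w : List (Fin L), w.length = p + 2 → |errorWord L p w| ≤ b) :
    ∃ δ₀ : ℝ, 0 < δ₀ ∧ ∀ t : ℝ, 0 ≤ t → t ≤ δ₀ →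
      ‖multError H p t - t ^ (p + 1) • commComb H p (leadingCoeff L p)‖
        ≤ (b + 1) * commNormSum H (p + 1) * t ^ (p + 2) := by
  have hα : 0 ≤ commNormSum H (p + 1) := sum_nonneg fun _ _ => norm_nonneg _
  rcases hα.eq_or_lt with h0 | hpos
  · have h := nestedComm_eq_zero_of_commNormSum_eq_zero hH (by omega) h0.symm
    refine ⟨1, one_pos, fun t _ _ => ?_⟩
    rw [multError_eq_zero H hp h, commComb_eq_zero H h, ← h0]
    simp
  · obtain ⟨K, hK⟩ := exists_norm_multError_sub_le H hp hb
    -- This radius ensures `K t ≤ α_{p+2}`, so the tail costs one more `α_{p+2} t^(p+2)`; `|K| + 1`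
    -- keeps the denominator positive.
    refine ⟨min 1 (commNormSum H (p + 1) / (|K| + 1)), by positivity, fun t ht0 ht => ?_⟩
    have hKt : K * t ≤ commNormSum H (p + 1) := by
      have h1 := (le_div_iff₀ (by positivity)).1 (ht.trans (min_le_right _ _))
      nlinarith [le_abs_self K]
    calc _ ≤ _ := hK t ht0 (ht.trans (min_le_left _ _))
      _ = b * commNormSum H (p + 1) * t ^ (p + 2) + K * t * t ^ (p + 2) := by ring
      _ ≤ b * commNormSum H (p + 1) * t ^ (p + 2) + commNormSum H (p + 1) * t ^ (p + 2) := by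
        gcongr
      _ = _ := by ring

end Remainder

/-! ### The observable error. -/

section Observable

variable {E : Type*} [NormedAddCommGroup E] [InnerProductSpace ℂ E] [CompleteSpace E]

theorem productFormula_eq {A : Type*} [NormedRing A] [NormedAlgebra ℂ A] [CompleteSpace A] {L : ℕ}
    (H : Fin L → A) (p : ℕ) (t : ℝ) :
    productFormula H p t = evolution (∑ l, H l) t * (1 + multError H p t) := by
  rw [multError, add_sub_cancel, ← mul_assoc, evolution_mul_neg, one_mul]

theorem norm_clm_le_one_of_mem_unitary {U : E →L[ℂ] E} (hU : U ∈ unitary (E →L[ℂ] E)) :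
    ‖U‖ ≤ 1 := by
  rw [← mul_one U, CStarRing.norm_mem_unitary_mul _ hU]
  exact ContinuousLinearMap.norm_id_le

/-- With `W = 1 + M` unitary, `Q - W† Q W = W† (W Q - Q W) = -W† [Q, M]`, and `W†` does not increase
norms. -/
theorem observableError_le_norm_lie {L : ℕ} {H : Fin L → (E →L[ℂ] E)}
    (hH : ∀ l, IsSelfAdjoint (H l)) (p : ℕ) (t : ℝ) (O : E →L[ℂ] E) {ψ : E} (hψ : ‖ψ‖ = 1) :
    observableError H p t O ψ
      ≤ ‖⁅heisenberg (∑ l, H l) O t, multError H p t⁆ ψ‖ := by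
  have hS : IsSelfAdjoint (∑ l, H l) := isSelfAdjoint_sum _ fun l _ => hH l
  set V := evolution (∑ l, H l) t with hV
  set V' := evolution (∑ l, H l) (-t) with hV'
  have hVu : V ∈ unitary (E →L[ℂ] E) := evolution_mem_unitary hS t
  have hV'u : V' ∈ unitary (E →L[ℂ] E) := evolution_mem_unitary hS (-t)
  have hVV : V * V' = 1 := evolution_mul_neg _ t
  have hstar : star V = V' := by
    rw [← mul_one (star V), ← hVV, ← mul_assoc, Unitary.star_mul_self_of_mem hVu, one_mul]
  set W := V' * productFormula H p t with hW
  have hWu : W ∈ unitary (E →L[ℂ] E) := mul_mem hV'u (productFormula_mem_unitary hH p t)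
  have hM : multError H p t = W - 1 := rfl
  have hU : productFormula H p t = V * W := by rw [hW, ← mul_assoc, hVV, one_mul]
  set Q := heisenberg (∑ l, H l) O t with hQ
  have hQe : Q = V' * O * V := rfl
  have key : Q - ContinuousLinearMap.adjoint (productFormula H p t) * O * productFormula H p t
      = -(star W * ⁅Q, multError H p t⁆) := by
    rw [← ContinuousLinearMap.star_eq_adjoint, hU, star_mul, hstar]
    have h1 : star W * V' * O * (V * W) = star W * Q * W := by
      rw [hQe]; simp only [mul_assoc]
    have h2 : star W * W = 1 := Unitary.star_mul_self_of_mem hWu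
    rw [h1, hM, Ring.lie_def]
    have h3 : Q = star W * W * Q := by rw [h2, one_mul]
    nth_rw 1 [h3]
    noncomm_ring
  rw [observableError, ← hQ, key]
  calc ‖inner ℂ ψ ((-(star W * ⁅Q, multError H p t⁆)) ψ)‖
      ≤ ‖ψ‖ * ‖(-(star W * ⁅Q, multError H p t⁆)) ψ‖ := norm_inner_le_norm _ _
    _ = ‖star W (⁅Q, multError H p t⁆ ψ)‖ := by
      rw [hψ, one_mul, neg_apply, norm_neg]
      rfl
    _ ≤ ‖star W‖ * ‖⁅Q, multError H p t⁆ ψ‖ := ContinuousLinearMap.le_opNorm _ _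
    _ ≤ ‖⁅Q, multError H p t⁆ ψ‖ := mul_le_of_le_one_left (norm_nonneg _)
      (norm_clm_le_one_of_mem_unitary (Unitary.star_mem hWu))

theorem observableError_le {L : ℕ} {H : Fin L → (E →L[ℂ] E)} (hH : ∀ l, IsSelfAdjoint (H l))
    (p : ℕ) {t : ℝ} (ht : 0 ≤ t) (O : E →L[ℂ] E) {ψ : E} (hψ : ‖ψ‖ = 1) {S R : E →L[ℂ] E}
    (hM : multError H p t = ((t : ℂ) ^ (p + 1)) • S + R) :
    observableError H p t O ψ
      ≤ ‖⁅heisenberg (∑ l, H l) O t, S⁆ ψ‖ * t ^ (p + 1) + 2 * ‖O‖ * ‖R‖ := by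
  have hS : IsSelfAdjoint (∑ l, H l) := isSelfAdjoint_sum _ fun l _ => hH l
  have hQ : ‖heisenberg (∑ l, H l) O t‖ = ‖O‖ := by
    rw [heisenberg, CStarRing.norm_mul_mem_unitary _ (evolution_mem_unitary hS _),
      CStarRing.norm_mem_unitary_mul _ (evolution_mem_unitary hS _)]
  refine (observableError_le_norm_lie hH p t O hψ).trans ?_
  rw [← hQ]
  generalize heisenberg (∑ l, H l) O t = Q
  have hsplit : ⁅Q, multError H p t⁆ = ((t : ℂ) ^ (p + 1)) • ⁅Q, S⁆ + ⁅Q, R⁆ := by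
    rw [hM, Ring.lie_def, Ring.lie_def, Ring.lie_def, mul_add, add_mul, mul_smul_comm,
      smul_mul_assoc, smul_sub]
    abel
  have hR : ‖⁅Q, R⁆ ψ‖ ≤ 2 * ‖Q‖ * ‖R‖ := by
    refine (ContinuousLinearMap.le_opNorm _ _).trans ?_
    rw [hψ, mul_one, Ring.lie_def]
    refine (norm_sub_le _ _).trans ?_
    linarith [norm_mul_le Q R, norm_mul_le R Q]
  rw [hsplit, add_apply, smul_apply]
  refine (norm_add_le _ _).trans (add_le_add ?_ hR)
  rw [norm_smul, norm_pow, Complex.norm_of_nonneg ht, mul_comm]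

end Observable

end Trotter

end

/-! ### Choice of constants and conclusion. -/

theorem mainTheorem1 (p : ℕ) (hp : p = 1 ∨ (2 ≤ p ∧ Even p)) :
    -- the constant `C` depends on `p` only; the coefficients `c` depend on `p` and `L` only
    ∃ C : ℝ, 0 < C ∧ ∀ L : ℕ, ∃ c : (Fin (p + 1) → Fin L) → ℝ, (∀ l, |c l| ≤ C) ∧
      ∀ (E : Type*) [NormedAddCommGroup E] [InnerProductSpace ℂ E] [CompleteSpace E]
        (H : Fin L → (E →L[ℂ] E)), (∀ l, IsSelfAdjoint (H l)) →
        -- `M j` is any decomposition of the leading error term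
        ∀ (J : Type) [Fintype J] (M : J → (E →L[ℂ] E)), ∑ j, M j = Trotter.commComb H p c →
          ∃ MRe : ℝ → (E →L[ℂ] E),
            (∀ t : ℝ, Trotter.productFormula H p t
              = Trotter.evolution (∑ l, H l) t * (1 + Trotter.multError H p t)) ∧
            (∀ t : ℝ, Trotter.multError H p t = ((t : ℂ) ^ (p + 1)) • ∑ j, M j + MRe t) ∧
            (∀ t : ℝ, 0 ≤ t → ∀ O : E →L[ℂ] E, IsSelfAdjoint O → ∀ ψ : E, ‖ψ‖ = 1 →
              Trotter.observableError H p t O ψ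
                ≤ ‖⁅Trotter.heisenberg (∑ l, H l) O t, ∑ j, M j⁆ ψ‖ * t ^ (p + 1)
                  + 2 * ‖O‖ * ‖MRe t‖) ∧
            ∃ δ₀ : ℝ, 0 < δ₀ ∧ ∀ t : ℝ, 0 ≤ t → t ≤ δ₀ →
              ‖MRe t‖ ≤ C * Trotter.commNormSum H (p + 1) * t ^ (p + 2) := by
  obtain ⟨b, hb⟩ := Trotter.exists_abs_errorWord_le p
  -- The first summand bounds the coefficients `c`. The second bounds the degree `p + 2` term, and
  -- the 1 pays for the absorbed tail.
  refine ⟨|b (p + 1)| + |b (p + 2)| + 1, by positivity, fun L =>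
    ⟨Trotter.leadingCoeff L p, fun l => ?_, ?_⟩⟩
  · have h1 : |Trotter.errorWord L p (List.ofFn l)| ≤ |b (p + 1)| := by
      simpa using (hb L (List.ofFn l)).trans (le_abs_self _)
    rw [Trotter.leadingCoeff, abs_div, abs_of_pos (by positivity : (0 : ℝ) < p + 1)]
    refine (div_le_self (abs_nonneg _) (by linarith [(Nat.cast_nonneg p : (0 : ℝ) ≤ p)])).trans ?_
    linarith [abs_nonneg (b (p + 2))]
  · intro E _ _ _ H hH J _ M hM
    have hMRe (t : ℝ) : Trotter.multError H p t = ((t : ℂ) ^ (p + 1)) • ∑ j, M j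
        + (Trotter.multError H p t - ((t : ℂ) ^ (p + 1)) • ∑ j, M j) := by abel
    refine ⟨fun t => Trotter.multError H p t - ((t : ℂ) ^ (p + 1)) • ∑ j, M j,
      Trotter.productFormula_eq H p, hMRe, fun t ht O _ ψ hψ =>
        Trotter.observableError_le hH p ht O hψ (hMRe t), ?_⟩
    obtain ⟨δ₀, hδ, h⟩ := Trotter.exists_norm_multError_sub_le_of_isSelfAdjoint hH hp
      (b := |b (p + 2)|) fun w hw => hw ▸ (hb L w).trans (le_abs_self _)
    refine ⟨δ₀, hδ, fun t ht0 ht => ?_⟩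
    have hα : 0 ≤ Trotter.commNormSum H (p + 1) := Finset.sum_nonneg fun _ _ => norm_nonneg _
    simp only [hM]
    rw [← Complex.ofReal_pow, Complex.coe_smul]
    refine (h t ht0 ht).trans ?_
    gcongr
    linarith [abs_nonneg (b (p + 1))]
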